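/- Let $n\ge 1$, let $\Omega\subset\mathbb R^n$ be a non-empty open set and $L^2_{\mathbb C}(\Omega)$ the complex Hilbert space of square-integrable functions for Lebesgue measure. For $1\le j\le n$ let $\partial^{e_j}$ be the weak partial derivative, $\partial^{e_j}:=-\big(C_0^\infty(\Omega,\mathbb C)\to L^2_{\mathbb C}(\Omega),\ \varphi\mapsto\partial\varphi/\partial x_j\big)^*$. Let $W^1_{\mathbb C}(\Omega):=\bigcap_{j}D(\partial^{e_j})$, with the norm $(\|u\|_2^2+\sum_j\|\partial^{e_j}u\|_2^2)^{1/2}$, let $W^1_{0,\mathbb C}(\Omega)$ be the closure of $C_0^\infty(\Omega,\mathbb C)$ in it, and $\nabla_w u:=(\partial^{e_1}u,\dots,\partial^{e_n}u)$ for $u\in W^1_{\mathbb C}(\Omega)$. Let $\nabla_0^*$ be the adjoint of the densely defined operator $\nabla_0:C_0^\infty(\Omega,\mathbb C)\to (L^2_{\mathbb C}(\Omega))^n$, $\nabla_0\varphi:=(\partial\varphi/\partial x_1,\dots,\partial\varphi/\partial x_n)$, in $L^2_{\mathbb C}(\Omega)$. Assume that a Poincaré inequality holds on $\Omega$: there are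 $j\in\{1,\dots,n\}$ and $c>0$ such that $\|\partial^{e_j}f\|_2\ge c\,\|f\|_2$ for every $f\in W^1_{0,\mathbb C}(\Omega)$. Let $\mathcal L$ be the set of all real-valued $\bar p\in L^\infty(\Omega)$ for which there are real $C_2\ge C_1>0$ with $C_1\le\bar p\le C_2$ a.e. on $\Omega$. For $\bar p\in\mathcal L$, let $\hat A_{\bar p}$ be the operator in the Hilbert space $H:=L^2_{\mathbb C}(\Omega)\times(L^2_{\mathbb C}(\Omega))^n$ with domain $W^1_{0,\mathbb C}(\Omega)\times D(\nabla_0^*)$ given by $$\hat A_{\bar p}(u,q):=\big(\nabla_0^*q,\ \nabla_w u-\bar p\,q\big).$$ Let $\bar p_1,\bar p_2,\dots$ be a sequence in $\mathcal L$ that is uniformly bounded, for which there is $\varepsilon>0$ such that $\bar p_\nu\ge\varepsilon$ a.e. on $\Omega$ for all $\nu$, and which converges pointwise a.e. on $\Omega$ to some $\bar p_\infty\in\mathcal L$. Write $\hat A_\nu:=\hat A_{\bar p_\nu}$ and $\hat A_\infty:=\hat A_{\bar p_\infty}$. Then $\hat A_\infty$ and all the $\hat A_\nu$ are self-adjoint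 and map their domain bijectively onto $H$ with bounded inverses, and $$\operatorname*{s-lim}_{\nu\to\infty}\hat A_\nu^{-1}=\hat A_\infty^{-1},$$ that is, $\lim_{\nu\to\infty}\|\hat A_\nu^{-1}y-\hat A_\infty^{-1}y\|=0$ for every $y\in H$. -/

import Mathlib

open MeasureTheory Filter Topology TopologicalSpace
open scoped ENNReal Distributions LinearPMap

namespace RoughDiffusion

noncomputable section

/-- The Hilbert space `L²_ℂ(Ω)` of an open set `Ω ⊆ ℝⁿ` with respect to Lebesgue measure. -/
abbrev L2 {n : ℕ} (Ω : Opens (EuclideanSpace ℝ (Fin n))) : Type :=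
  Lp ℂ 2 (volume.restrict (Ω : Set (EuclideanSpace ℝ (Fin n))))

/-- The Hilbert space `(L²_ℂ(Ω))ⁿ`, with scalar product `∑ j, ⟨f j | g j⟩`. -/
abbrev L2n {n : ℕ} (Ω : Opens (EuclideanSpace ℝ (Fin n))) : Type :=
  PiLp 2 (fun _ : Fin n => L2 Ω)

/-- The Hilbert space `L²_ℂ(Ω) × (L²_ℂ(Ω))ⁿ`, with the sum of the two scalar products. -/
abbrev MixedSpace {n : ℕ} (Ω : Opens (EuclideanSpace ℝ (Fin n))) : Type :=
  WithLp 2 (L2 Ω × L2n Ω)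

/-- The space of real-valued (classes of) functions `L^∞(Ω)`. -/
abbrev LInfty {n : ℕ} (Ω : Opens (EuclideanSpace ℝ (Fin n))) : Type :=
  Lp ℝ ∞ (volume.restrict (Ω : Set (EuclideanSpace ℝ (Fin n))))

variable {n : ℕ} {Ω : Opens (EuclideanSpace ℝ (Fin n))}

theorem testFunction_memLp (φ : 𝓓(Ω, ℂ)) :
    MemLp (⇑φ) 2 (volume.restrict (Ω : Set (EuclideanSpace ℝ (Fin n)))) :=
  (φ.continuous.memLp_of_hasCompactSupport φ.hasCompactSupport).restrict _

variable (Ω)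

/-- The class in `L²_ℂ(Ω)` of a test function `φ ∈ C₀^∞(Ω, ℂ)`. -/
def testToL2 : 𝓓(Ω, ℂ) →ₗ[ℂ] L2 Ω where
  toFun φ := (testFunction_memLp φ).toLp φ
  map_add' φ ψ := MemLp.toLp_add (testFunction_memLp φ) (testFunction_memLp ψ)
  map_smul' c φ := MemLp.toLp_const_smul c (testFunction_memLp φ)

theorem testToL2_injective : Function.Injective (testToL2 Ω) := by
  intro φ ψ h
  have h1 : ⇑φ =ᵐ[volume.restrict (Ω : Set (EuclideanSpace ℝ (Fin n)))] ⇑ψ :=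
    (MemLp.toLp_eq_toLp_iff (testFunction_memLp φ) (testFunction_memLp ψ)).1 h
  have h2 : Set.EqOn φ ψ (Ω : Set (EuclideanSpace ℝ (Fin n))) :=
    Measure.eqOn_open_of_ae_eq h1 Ω.isOpen φ.continuous.continuousOn ψ.continuous.continuousOn
  ext x
  by_cases hx : x ∈ (Ω : Set (EuclideanSpace ℝ (Fin n)))
  · exact h2 hx
  · rw [image_eq_zero_of_notMem_tsupport fun hx' => hx (φ.tsupport_subset hx'),
      image_eq_zero_of_notMem_tsupport fun hx' => hx (ψ.tsupport_subset hx')]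

/-- A linear map on `C₀^∞(Ω, ℂ)`, regarded as a partially defined linear operator in `L²_ℂ(Ω)`
with domain `C₀^∞(Ω, ℂ)`. -/
def onTestFunctions {F : Type*} [AddCommGroup F] [Module ℂ F] (T : 𝓓(Ω, ℂ) →ₗ[ℂ] F) :
    L2 Ω →ₗ.[ℂ] F where
  domain := LinearMap.range (testToL2 Ω)
  toFun := T ∘ₗ (LinearEquiv.ofInjective (testToL2 Ω) (testToL2_injective Ω)).symm.toLinearMap

/-- The class in `L²_ℂ(Ω)` of the classical partial derivative `∂φ/∂xⱼ` of a test function. -/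
def testPartial (j : Fin n) : 𝓓(Ω, ℂ) →ₗ[ℂ] L2 Ω :=
  testToL2 Ω ∘ₗ
    (TestFunction.lineDerivCLM ℂ (EuclideanSpace.single j (1 : ℝ)) : 𝓓(Ω, ℂ) →L[ℂ] 𝓓(Ω, ℂ))

/-- The classical gradient `(∂φ/∂x₁, …, ∂φ/∂xₙ)` of a test function. -/
def testGrad : 𝓓(Ω, ℂ) →ₗ[ℂ] L2n Ω :=
  (WithLp.linearEquiv 2 ℂ (Fin n → L2 Ω)).symm.toLinearMap ∘ₗ LinearMap.pi (testPartial Ω)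

/-- The gradient operator `∇₀ : C₀^∞(Ω, ℂ) → (L²_ℂ(Ω))ⁿ` in `L²_ℂ(Ω)`. -/
def grad0 : L2 Ω →ₗ.[ℂ] L2n Ω := onTestFunctions Ω (testGrad Ω)

/-- The weak partial derivative `∂^{e_j} = -(C₀^∞(Ω, ℂ) → L²_ℂ(Ω), φ ↦ ∂φ/∂xⱼ)^*`. -/
def weakPartial (j : Fin n) : L2 Ω →ₗ.[ℂ] L2 Ω := -(onTestFunctions Ω (testPartial Ω j))†

/-- The Sobolev space `W¹_ℂ(Ω) = ⋂ⱼ D(∂^{e_j})`. -/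
def W1 : Submodule ℂ (L2 Ω) := ⨅ j, (weakPartial Ω j).domain

/-- The weak gradient `∇_w : W¹_ℂ(Ω) → (L²_ℂ(Ω))ⁿ`, `∇_w u = (∂^{e_1} u, …, ∂^{e_n} u)`. -/
def weakGrad : W1 Ω →ₗ[ℂ] L2n Ω :=
  (WithLp.linearEquiv 2 ℂ (Fin n → L2 Ω)).symm.toLinearMap ∘ₗ
    LinearMap.pi fun j =>
      (weakPartial Ω j).toFun ∘ₗ Submodule.inclusion (iInf_le (fun j => (weakPartial Ω j).domain) j)

/-- The map `u ↦ (u, ∇_w u)`, so that the Sobolev norm of `u ∈ W¹_ℂ(Ω)` is `‖sobolevEmb Ω u‖`. -/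
def sobolevEmb : W1 Ω →ₗ[ℂ] MixedSpace Ω :=
  (WithLp.linearEquiv 2 ℂ (L2 Ω × L2n Ω)).symm.toLinearMap ∘ₗ
    LinearMap.prod (W1 Ω).subtype (weakGrad Ω)

/-- The space `W¹_{0,ℂ}(Ω)` as a subspace of `W¹_ℂ(Ω)`: the closure of `C₀^∞(Ω, ℂ)` in `W¹_ℂ(Ω)`
with respect to the Sobolev norm. -/
def W10 : Submodule ℂ (W1 Ω) :=
  (((LinearMap.range (testToL2 Ω)).comap (W1 Ω).subtype).map
    (sobolevEmb Ω)).topologicalClosure.comap (sobolevEmb Ω)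

theorem mem_W10_iff (u : W1 Ω) :
    u ∈ W10 Ω ↔ ∀ ε > 0, ∃ v : W1 Ω, (∃ φ : 𝓓(Ω, ℂ), testToL2 Ω φ = v) ∧
      ‖sobolevEmb Ω (u - v)‖ < ε := by
  have h : u ∈ W10 Ω ↔ sobolevEmb Ω u ∈
      closure (sobolevEmb Ω '' {v : W1 Ω | ∃ φ : 𝓓(Ω, ℂ), testToL2 Ω φ = v}) := Iff.rfl
  rw [h, Metric.mem_closure_iff]
  simp only [Set.exists_mem_image, dist_eq_norm, map_sub, Set.mem_ofPred_eq]

/-- The Poincaré inequality: for some `j` and some `c > 0`, `‖∂^{e_j} f‖ ≥ c ‖f‖` for every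
`f ∈ W¹_{0,ℂ}(Ω)`. -/
def PoincareInequality : Prop :=
  ∃ j : Fin n, ∃ c : ℝ, 0 < c ∧ ∀ f ∈ W10 Ω, c * ‖(f : L2 Ω)‖ ≤ ‖weakGrad Ω f j‖

/-- The class `𝓛` of all `p ∈ L^∞(Ω)` with `C₁ ≤ p ≤ C₂` a.e. for some `0 < C₁ ≤ C₂`. -/
def diffusivityClass : Set (LInfty Ω) :=
  {p | ∃ C₁ C₂ : ℝ, 0 < C₁ ∧ C₁ ≤ C₂ ∧
    ∀ᵐ x ∂(volume.restrict (Ω : Set (EuclideanSpace ℝ (Fin n)))), C₁ ≤ p x ∧ p x ≤ C₂}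

variable {Ω}

/-- Componentwise multiplication `q ↦ (p q₁, …, p qₙ)` with `p ∈ L^∞(Ω)`. -/
def mulOp (p : LInfty Ω) : L2n Ω →ₗ[ℂ] L2n Ω where
  toFun q := WithLp.toLp 2 fun j => (p • q j : L2 Ω)
  map_add' q r := by
    ext1 j
    exact Lp.add_smul p (q j) (r j)
  map_smul' c q := by
    ext1 j
    refine Lp.ext ?_
    filter_upwards [Lp.coeFn_lpSMul (r := 2) p (c • q j), Lp.coeFn_lpSMul (r := 2) p (q j),
      Lp.coeFn_smul c (q j), Lp.coeFn_smul c (p • q j : L2 Ω)] with x h1 h2 h3 h4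
    refine h1.trans (Eq.trans ?_ h4.symm)
    simp only [Pi.smul_apply', Pi.smul_apply, h2, h3]
    exact smul_comm _ _ _

/-- The domain `W¹_{0,ℂ}(Ω) × D(∇₀^*)`, as a subspace of `L²_ℂ(Ω) × (L²_ℂ(Ω))ⁿ`. -/
def mixedDomain (Ω : Opens (EuclideanSpace ℝ (Fin n))) : Submodule ℂ (MixedSpace Ω) :=
  (((W10 Ω).map (W1 Ω).subtype).prod ((grad0 Ω)†).domain).comap
    (WithLp.linearEquiv 2 ℂ (L2 Ω × L2n Ω)).toLinearMap

theorem mixedDomain_fst_mem (x : mixedDomain Ω) : (x : MixedSpace Ω).fst ∈ W1 Ω :=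
  Submodule.map_subtype_le _ _ x.2.1

theorem mixedDomain_snd_mem (x : mixedDomain Ω) : (x : MixedSpace Ω).snd ∈ ((grad0 Ω)†).domain :=
  x.2.2

/-- The first-order operator `Â (u, q) = (∇₀^* q, ∇_w u - p q)` with domain
`W¹_{0,ℂ}(Ω) × D(∇₀^*)`. -/
def mixedOp (p : LInfty Ω) : MixedSpace Ω →ₗ.[ℂ] MixedSpace Ω where
  domain := mixedDomain Ω
  toFun :=
    { toFun := fun x => WithLp.toLp 2
        ((grad0 Ω)† ⟨(x : MixedSpace Ω).snd, mixedDomain_snd_mem x⟩,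
          weakGrad Ω ⟨(x : MixedSpace Ω).fst, mixedDomain_fst_mem x⟩
            - mulOp p (x : MixedSpace Ω).snd)
      map_add' := fun x y => by
        apply (WithLp.equiv 2 (L2 Ω × L2n Ω)).injective
        refine Prod.ext ?_ ?_
        · exact map_add ((grad0 Ω)†).toFun ⟨(x : MixedSpace Ω).snd, mixedDomain_snd_mem x⟩
            ⟨(y : MixedSpace Ω).snd, mixedDomain_snd_mem y⟩
        · have h1 := map_add (weakGrad Ω) ⟨(x : MixedSpace Ω).fst, mixedDomain_fst_mem x⟩
            ⟨(y : MixedSpace Ω).fst, mixedDomain_fst_mem y⟩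
          have h2 := map_add (mulOp p) (x : MixedSpace Ω).snd (y : MixedSpace Ω).snd
          exact (congrArg₂ (· - ·) h1 h2).trans (add_sub_add_comm _ _ _ _)
      map_smul' := fun c x => by
        apply (WithLp.equiv 2 (L2 Ω × L2n Ω)).injective
        refine Prod.ext ?_ ?_
        · exact map_smul ((grad0 Ω)†).toFun c ⟨(x : MixedSpace Ω).snd, mixedDomain_snd_mem x⟩
        · have h1 := map_smul (weakGrad Ω) c ⟨(x : MixedSpace Ω).fst, mixedDomain_fst_mem x⟩
          have h2 := map_smul (mulOp p) c (x : MixedSpace Ω).snd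
          exact (congrArg₂ (· - ·) h1 h2).trans (smul_sub _ _ _).symm }

/-- `B` is the inverse of the partially defined operator `A`: `A` maps its domain bijectively onto
the whole space, and its inverse is the bounded operator `B`. -/
def IsBoundedInverse {H : Type*} [NormedAddCommGroup H] [NormedSpace ℂ H]
    (A : H →ₗ.[ℂ] H) (B : H →L[ℂ] H) : Prop :=
  (∀ x : A.domain, B (A x) = x) ∧ ∀ y : H, ∃ h : B y ∈ A.domain, A ⟨B y, h⟩ = y

end

end RoughDiffusion

/-!
Let `D` be the weak gradient with domain `W¹₀(Ω)`. Its graph is the closure of the set of the pairs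
`(φ, ∇φ)` with test functions `φ`, and the orthogonal complement of that set is, up to a sign and a
swap of the components, the graph of `∇₀^*`. Taking the orthogonal complement twice gives
`D = (∇₀^*)^*` (`hasGrad0_iff`). Hence the off-diagonal operator with the entries `∇₀^*` and `D` is
self-adjoint, and so is `Â`, which differs from it by the bounded symmetric operator of
multiplication by the real function `p` (`isSelfAdjoint_mixedOp`).

If `Â(u, q) = (f, g)`, that is, `∇₀^* q = f` and `D u = g + p q`, then pairing the second equation
with `q` bounds `ε ‖q‖²` by `‖f‖ ‖u‖ + ‖g‖ ‖q‖`, and the Poincaré inequality bounds `u` by `D u`.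
Together they give `‖(u, q)‖ ≤ K ‖Â(u, q)‖`, where `K` depends only on the bounds of `p` and on the
Poincaré constant (`exists_norm_le_mul_norm_mixedOp`). A self-adjoint operator that is bounded below
is a bijection of its domain onto the whole space (`exists_isBoundedInverse`).

The constant `K` is the same for the whole sequence, and on the common domain `Â_ν → Â_∞` pointwise
by dominated convergence (`tendsto_mixedOp`). The identity
`Â_ν⁻¹ - Â_∞⁻¹ = Â_ν⁻¹ (Â_∞ - Â_ν) Â_∞⁻¹` then gives strong convergence of the inverses
(`tendsto_inverse_of_tendsto`).
-/

namespace RoughDiffusion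

/-! ### Test functions in `L²(Ω)` -/

section TestFunctions

variable {n : ℕ} (Ω : Opens (EuclideanSpace ℝ (Fin n)))

theorem coeFn_testToL2 (φ : 𝓓(Ω, ℂ)) :
    testToL2 Ω φ =ᵐ[volume.restrict (Ω : Set (EuclideanSpace ℝ (Fin n)))] φ :=
  MemLp.coeFn_toLp (testFunction_memLp φ)

/-- The scalar product with a test function, as an integral over the whole of `ℝⁿ`: the test
function vanishes off `Ω`, whatever the values of `f` are there. -/
theorem inner_testToL2_left (φ : 𝓓(Ω, ℂ)) (f : L2 Ω) :
    inner ℂ (testToL2 Ω φ) f = ∫ x, f x * starRingEnd ℂ (φ x) := by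
  have h : inner ℂ (testToL2 Ω φ) f
      = ∫ x in (Ω : Set (EuclideanSpace ℝ (Fin n))), f x * starRingEnd ℂ (φ x) := by
    rw [L2.inner_def]
    refine integral_congr_ae ?_
    filter_upwards [coeFn_testToL2 Ω φ] with x hx
    rw [hx, RCLike.inner_apply]
  rw [h]
  refine setIntegral_eq_integral_of_forall_compl_eq_zero fun x hx => ?_
  rw [image_eq_zero_of_notMem_tsupport fun hx' => hx (φ.tsupport_subset hx'), map_zero, mul_zero]

/-- Test functions are total in `L²(Ω)`: a square-integrable function is locally integrable, so the
fundamental lemma of the calculus of variations applies. -/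
theorem eq_zero_of_forall_inner_testToL2 (f : L2 Ω)
    (hf : ∀ φ : 𝓓(Ω, ℂ), inner ℂ (testToL2 Ω φ) f = 0) : f = 0 := by
  have hloc : LocallyIntegrableOn (f : EuclideanSpace ℝ (Fin n) → ℂ)
      (Ω : Set (EuclideanSpace ℝ (Fin n))) volume := by
    refine (locallyIntegrableOn_iff Ω.isOpen.isLocallyClosed).2 fun K hK hKc => ?_
    have h1 : MemLp f 2 ((volume.restrict (Ω : Set (EuclideanSpace ℝ (Fin n)))).restrict K) :=
      (Lp.memLp f).restrict K
    rw [Measure.restrict_restrict_of_subset hK] at h1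
    have : IsFiniteMeasure (volume.restrict K) := ⟨by simpa using hKc.measure_lt_top⟩
    exact h1.integrable one_le_two
  have h := Ω.isOpen.ae_eq_zero_of_integral_contDiff_smul_eq_zero hloc fun g hg hgc hgs => by
    have hc : tsupport (fun x => (g x : ℂ)) ⊆ tsupport g :=
      closure_mono fun x hx h0 => hx (by simp [h0])
    have := hf ⟨fun x => (g x : ℂ), Complex.ofRealCLM.contDiff.comp hg,
      hgc.comp_left Complex.ofReal_zero, hc.trans hgs⟩
    rw [inner_testToL2_left] at this
    rw [← this]
    refine integral_congr_ae (Eventually.of_forall fun x => ?_)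
    change (g x : ℂ) * f x = f x * starRingEnd ℂ (g x : ℂ)
    rw [Complex.conj_ofReal, mul_comm]
  refine Lp.ext ?_
  filter_upwards [(ae_restrict_iff' Ω.isOpen.measurableSet).2 h,
    Lp.coeFn_zero ℂ 2 (volume.restrict (Ω : Set (EuclideanSpace ℝ (Fin n))))]
    with x h1 h2
  rw [h1, h2, Pi.zero_apply]

theorem dense_range_testToL2 : Dense (LinearMap.range (testToL2 Ω) : Set (L2 Ω)) := by
  rw [Submodule.dense_iff_topologicalClosure_eq_top, Submodule.topologicalClosure_eq_top_iff,
    Submodule.eq_bot_iff]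
  intro f hf
  exact eq_zero_of_forall_inner_testToL2 Ω f fun φ => hf _ ⟨φ, rfl⟩

/-- Integration by parts: there are no boundary terms for test functions. -/
theorem inner_testPartial_left (j : Fin n) (φ ψ : 𝓓(Ω, ℂ)) :
    inner ℂ (testPartial Ω j φ) (testToL2 Ω ψ) = -inner ℂ (testToL2 Ω φ) (testPartial Ω j ψ) := by
  have key : ∀ a b : 𝓓(Ω, ℂ), inner ℂ (testToL2 Ω a) (testToL2 Ω b)
      = ∫ x, starRingEnd ℂ (a x) * b x := fun a b => by
    rw [L2.inner_def]
    have h : ∫ x in (Ω : Set (EuclideanSpace ℝ (Fin n))), inner ℂ (testToL2 Ω a x) (testToL2 Ω b x)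
        = ∫ x in (Ω : Set (EuclideanSpace ℝ (Fin n))), starRingEnd ℂ (a x) * b x := by
      refine integral_congr_ae ?_
      filter_upwards [coeFn_testToL2 Ω a, coeFn_testToL2 Ω b] with x ha hb
      rw [ha, hb, RCLike.inner_apply, mul_comm]
    rw [h]
    refine setIntegral_eq_integral_of_forall_compl_eq_zero fun x hx => ?_
    rw [image_eq_zero_of_notMem_tsupport fun hx' => hx (b.tsupport_subset hx'), mul_zero]
  have hd : ∀ (a : 𝓓(Ω, ℂ)) x, (TestFunction.lineDerivCLM ℂ (EuclideanSpace.single j (1 : ℝ)) a :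
      𝓓(Ω, ℂ)) x = fderiv ℝ a x (EuclideanSpace.single j (1 : ℝ)) := fun a x => by
    rw [TestFunction.lineDerivCLM_apply_of_le (by simp),
      (a.contDiff.differentiable (by simp)).differentiableAt.lineDeriv_eq_fderiv]
  have hint : ∀ a b : 𝓓(Ω, ℂ), Integrable (fun x => starRingEnd ℂ (a x) * b x) := fun a b => by
    refine Continuous.integrable_of_hasCompactSupport ?_ ?_
    · exact (Complex.continuous_conj.comp a.continuous).mul b.continuous
    · exact b.hasCompactSupport.mul_left
  simp only [testPartial, LinearMap.comp_apply, ContinuousLinearMap.coe_coe, key]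
  have hφ : ∀ x, HasFDerivAt (fun y => starRingEnd ℂ (φ y))
      ((Complex.conjCLE : ℂ →L[ℝ] ℂ).comp (fderiv ℝ φ x)) x := fun x =>
    (Complex.conjCLE : ℂ →L[ℝ] ℂ).hasFDerivAt.comp x
      (φ.contDiff.differentiable (by simp)).differentiableAt.hasFDerivAt
  have hψ : ∀ x, HasFDerivAt ψ (fderiv ℝ ψ x) x := fun x =>
    (ψ.contDiff.differentiable (by simp)).differentiableAt.hasFDerivAt
  have := integral_bilinear_hasFDerivAt_right_eq_neg_left_of_integrable (μ := volume)
    (v := EuclideanSpace.single j (1 : ℝ)) (B := ContinuousLinearMap.mul ℝ ℂ)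
    (f := fun y => starRingEnd ℂ (φ y)) (g := ψ)
    (f' := fun x => (Complex.conjCLE : ℂ →L[ℝ] ℂ).comp (fderiv ℝ φ x)) (g' := fun x => fderiv ℝ ψ x)
    (by simpa [hd] using hint (TestFunction.lineDerivCLM ℂ (EuclideanSpace.single j (1 : ℝ)) φ) ψ)
    (by simpa [hd] using hint φ (TestFunction.lineDerivCLM ℂ (EuclideanSpace.single j (1 : ℝ)) ψ))
    (hint φ ψ) (fun x _ => hφ x) (fun x _ => hψ x)
  simp only [ContinuousLinearMap.mul_apply'] at this
  simp only [hd, this, neg_neg]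
  -- The derivative of the conjugate of `φ` is the conjugate of the derivative, by definition.
  rfl

theorem dense_domain_onTestFunctions {F : Type*} [AddCommGroup F] [Module ℂ F]
    (T : 𝓓(Ω, ℂ) →ₗ[ℂ] F) : Dense ((onTestFunctions Ω T).domain : Set (L2 Ω)) :=
  dense_range_testToL2 Ω

theorem onTestFunctions_apply {F : Type*} [AddCommGroup F] [Module ℂ F]
    (T : 𝓓(Ω, ℂ) →ₗ[ℂ] F) (φ : 𝓓(Ω, ℂ)) (h : testToL2 Ω φ ∈ (onTestFunctions Ω T).domain) :
    onTestFunctions Ω T ⟨testToL2 Ω φ, h⟩ = T φ := by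
  have : (LinearEquiv.ofInjective (testToL2 Ω) (testToL2_injective Ω)).symm ⟨testToL2 Ω φ, h⟩ = φ :=
    (LinearEquiv.symm_apply_eq _).2 (Subtype.ext rfl)
  exact congrArg T this

/-- An operator on test functions is densely defined, so its adjoint is the genuine one, given by
the defining relation, and not the junk value for domains that are not dense. -/
theorem mem_graph_adjoint_onTestFunctions_iff {F : Type*} [NormedAddCommGroup F]
    [InnerProductSpace ℂ F] (T : 𝓓(Ω, ℂ) →ₗ[ℂ] F) (q : F) (f : L2 Ω) :
    (q, f) ∈ ((onTestFunctions Ω T)†).graph ↔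
      ∀ φ, inner ℂ f (testToL2 Ω φ) = inner ℂ q (T φ) := by
  rw [LinearPMap.adjoint_graph_eq_graph_adjoint (dense_domain_onTestFunctions Ω T),
    Submodule.mem_adjoint_iff]
  constructor
  · intro h φ
    have h1 := h (testToL2 Ω φ) (T φ)
      ((LinearPMap.mem_graph_iff _).2 ⟨⟨testToL2 Ω φ, φ, rfl⟩, rfl, onTestFunctions_apply Ω T φ _⟩)
    rw [← inner_conj_symm f, ← inner_conj_symm q, sub_eq_zero.1 h1]
  · rintro h a b hab
    obtain ⟨⟨_, φ, rfl⟩, rfl, rfl⟩ := (LinearPMap.mem_graph_iff _).1 hab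
    refine (congrArg (fun z => inner ℂ z q - inner ℂ (testToL2 Ω φ) f)
      (onTestFunctions_apply Ω T φ _)).trans ?_
    rw [← inner_conj_symm, ← inner_conj_symm _ f, h φ, sub_self]

theorem testGrad_apply (φ : 𝓓(Ω, ℂ)) (j : Fin n) : testGrad Ω φ j = testPartial Ω j φ := rfl

end TestFunctions

/-! ### The weak gradient on `W¹₀(Ω)` as the adjoint of `∇₀^*` -/

section MinimalGradient

variable {n : ℕ} (Ω : Opens (EuclideanSpace ℝ (Fin n)))

theorem exists_weakPartial_eq_iff (j : Fin n) (u g : L2 Ω) :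
    (∃ h : u ∈ (weakPartial Ω j).domain, weakPartial Ω j ⟨u, h⟩ = g) ↔
      ∀ φ, inner ℂ g (testToL2 Ω φ) = -inner ℂ u (testPartial Ω j φ) := by
  have h := mem_graph_adjoint_onTestFunctions_iff Ω (testPartial Ω j) u (-g)
  simp only [inner_neg_left, neg_eq_iff_eq_neg] at h
  rw [← h, LinearPMap.mem_graph_iff]
  constructor
  · rintro ⟨hu, rfl⟩
    exact ⟨⟨u, hu⟩, rfl, (neg_neg _).symm⟩
  · rintro ⟨⟨_, hu⟩, rfl, hg⟩
    exact ⟨hu, (congrArg Neg.neg hg).trans (neg_neg g)⟩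

/-- Membership in `W¹(Ω)` and the value of the weak gradient, in terms of test functions. -/
theorem exists_weakGrad_eq_iff (u : L2 Ω) (r : L2n Ω) :
    (∃ h : u ∈ W1 Ω, weakGrad Ω ⟨u, h⟩ = r) ↔
      ∀ j φ, inner ℂ (r j) (testToL2 Ω φ) = -inner ℂ u (testPartial Ω j φ) := by
  simp only [← exists_weakPartial_eq_iff]
  constructor
  · rintro ⟨h, rfl⟩ j
    exact ⟨(Submodule.mem_iInf _).1 h j, rfl⟩
  · intro h
    refine ⟨(Submodule.mem_iInf _).2 fun j => (h j).1, ?_⟩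
    ext1 j
    exact (h j).2

theorem exists_weakGrad_testToL2 (φ : 𝓓(Ω, ℂ)) :
    ∃ h : testToL2 Ω φ ∈ W1 Ω, weakGrad Ω ⟨testToL2 Ω φ, h⟩ = testGrad Ω φ :=
  (exists_weakGrad_eq_iff Ω _ _).2 fun j ψ => inner_testPartial_left Ω j φ ψ

/-- The set of the pairs `(φ, ∇φ)` with a test function `φ`: the graph of `∇₀`, as a subspace of the
Hilbert space that carries the Sobolev norm. -/
noncomputable def testGraph : Submodule ℂ (MixedSpace Ω) :=
  ((LinearMap.range (testToL2 Ω)).comap (W1 Ω).subtype).map (sobolevEmb Ω)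

theorem mem_testGraph_iff (z : MixedSpace Ω) :
    z ∈ testGraph Ω ↔ ∃ φ, WithLp.toLp 2 (testToL2 Ω φ, testGrad Ω φ) = z := by
  constructor
  · rintro ⟨⟨_, h⟩, ⟨φ, rfl⟩, rfl⟩
    obtain ⟨_, h2⟩ := exists_weakGrad_testToL2 Ω φ
    exact ⟨φ, congrArg (fun r => WithLp.toLp 2 (testToL2 Ω φ, r)) h2.symm⟩
  · rintro ⟨φ, rfl⟩
    obtain ⟨h1, h2⟩ := exists_weakGrad_testToL2 Ω φ
    exact ⟨⟨testToL2 Ω φ, h1⟩, ⟨φ, rfl⟩, congrArg (fun r => WithLp.toLp 2 (testToL2 Ω φ, r)) h2⟩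

theorem mem_testGraph_orthogonal_iff (z : MixedSpace Ω) :
    z ∈ (testGraph Ω)ᗮ ↔ (z.snd, -z.fst) ∈ ((grad0 Ω)†).graph := by
  rw [grad0, mem_graph_adjoint_onTestFunctions_iff, Submodule.mem_orthogonal']
  have key : ∀ φ, inner ℂ z (WithLp.toLp 2 (testToL2 Ω φ, testGrad Ω φ))
      = inner ℂ z.fst (testToL2 Ω φ) + inner ℂ z.snd (testGrad Ω φ) := fun φ =>
    WithLp.prod_inner_apply _ _
  simp only [mem_testGraph_iff, forall_exists_index, forall_apply_eq_imp_iff, key, inner_neg_left,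
    neg_eq_iff_add_eq_zero]

/-- The graph of the weak gradient is closed. -/
theorem isClosed_range_sobolevEmb :
    IsClosed (LinearMap.range (sobolevEmb Ω) : Set (MixedSpace Ω)) := by
  have h : (LinearMap.range (sobolevEmb Ω) : Set (MixedSpace Ω)) = ⋂ (j : Fin n) (φ : 𝓓(Ω, ℂ)),
      {z | inner ℂ (z.snd j) (testToL2 Ω φ) = -inner ℂ z.fst (testPartial Ω j φ)} := by
    ext z
    simp only [Set.mem_iInter, Set.mem_ofPred_eq]
    refine Iff.trans ?_ (exists_weakGrad_eq_iff Ω z.fst z.snd)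
    constructor
    · rintro ⟨⟨u, hu⟩, rfl⟩
      exact ⟨hu, rfl⟩
    · rintro ⟨hu, hr⟩
      exact ⟨⟨z.fst, hu⟩, congrArg (fun r => WithLp.toLp 2 (z.fst, r)) hr⟩
  rw [h]
  refine isClosed_iInter fun j => isClosed_iInter fun φ => isClosed_eq ?_ ?_ <;> fun_prop

/-- `r` is the weak gradient of `v`, and `v` belongs to `W¹₀(Ω)`: the graph of the weak gradient
with domain `W¹₀(Ω)`, as a relation. -/
def HasGrad0 (v : L2 Ω) (r : L2n Ω) : Prop :=
  ∃ h : v ∈ W1 Ω, ⟨v, h⟩ ∈ W10 Ω ∧ weakGrad Ω ⟨v, h⟩ = r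

/-- The weak gradient with domain `W¹₀(Ω)`, being the closure of `∇₀`, is the adjoint of `∇₀^*`. -/
theorem hasGrad0_iff (v : L2 Ω) (r : L2n Ω) :
    HasGrad0 Ω v r ↔ ∀ q f, (q, f) ∈ ((grad0 Ω)†).graph → inner ℂ f v = inner ℂ q r := by
  have hcl : HasGrad0 Ω v r ↔ WithLp.toLp 2 (v, r) ∈ (testGraph Ω).topologicalClosure := by
    constructor
    -- `testGraph` is the subspace whose closure defines `W10`.
    · rintro ⟨h, h0, rfl⟩
      exact h0
    · intro h
      have hle : (testGraph Ω).topologicalClosure ≤ LinearMap.range (sobolevEmb Ω) :=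
        Submodule.topologicalClosure_minimal _ LinearMap.map_le_range (isClosed_range_sobolevEmb Ω)
      obtain ⟨⟨u, hu⟩, hz⟩ := hle h
      have hv : u = v := congrArg WithLp.fst hz
      subst hv
      have h0 : sobolevEmb Ω ⟨u, hu⟩ ∈ (testGraph Ω).topologicalClosure := by rwa [hz]
      exact ⟨hu, h0, congrArg WithLp.snd hz⟩
  rw [hcl, ← Submodule.orthogonal_orthogonal_eq_closure, Submodule.mem_orthogonal]
  simp only [mem_testGraph_orthogonal_iff]
  constructor
  · intro h q f hqf
    have h1 : inner ℂ (-f) v + inner ℂ q r = 0 :=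
      (WithLp.prod_inner_apply (𝕜 := ℂ) _ _).symm.trans
        (h (WithLp.toLp 2 (-f, q)) (by simpa using hqf))
    rwa [inner_neg_left, neg_add_eq_zero] at h1
  · intro h z hz
    refine (WithLp.prod_inner_apply _ _).trans ?_
    have h1 := h _ _ hz
    rw [inner_neg_left, neg_eq_iff_add_eq_zero] at h1
    exact h1

theorem hasGrad0_testToL2 (φ : 𝓓(Ω, ℂ)) : HasGrad0 Ω (testToL2 Ω φ) (testGrad Ω φ) :=
  (hasGrad0_iff Ω _ _).2 fun q f h => (mem_graph_adjoint_onTestFunctions_iff Ω _ q f).1 h φ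

theorem hasGrad0_zero : HasGrad0 Ω 0 0 :=
  (hasGrad0_iff Ω 0 0).2 fun _ _ _ => by rw [inner_zero_right, inner_zero_right]

theorem inner_piLp_single_left (j : Fin n) (f : L2 Ω) (q : L2n Ω) :
    inner ℂ (PiLp.single 2 j f) q = inner ℂ f (q j) := by
  rw [PiLp.inner_apply, Finset.sum_eq_single j, PiLp.single_eq_same]
  · intro i _ hi
    rw [PiLp.single_eq_of_ne 2 hi, inner_zero_left]
  · exact fun h => absurd (Finset.mem_univ j) h

/-- Vector fields with a single non-zero component, which is a test function, lie in `D(∇₀^*)`. -/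
theorem single_testToL2_mem_graph_adjoint_grad0 (j : Fin n) (ψ : 𝓓(Ω, ℂ)) :
    (PiLp.single 2 j (testToL2 Ω ψ), -testPartial Ω j ψ) ∈ ((grad0 Ω)†).graph := by
  refine (mem_graph_adjoint_onTestFunctions_iff Ω _ _ _).2 fun φ => ?_
  rw [inner_neg_left, inner_testPartial_left, neg_neg]
  rw [inner_piLp_single_left, testGrad_apply]

end MinimalGradient

/-! ### Inverses of self-adjoint operators that are bounded below -/

section BoundedBelow

variable {H : Type*} [NormedAddCommGroup H] [InnerProductSpace ℂ H]

/-- A self-adjoint operator that is bounded below is onto: its range is closed because the graph is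
complete, and dense because the orthogonal complement of the range lies in the kernel. -/
theorem exists_apply_eq_of_isSelfAdjoint_of_bound [CompleteSpace H] {A : H →ₗ.[ℂ] H}
    (hA : IsSelfAdjoint A) {K : ℝ}
    (hK : ∀ x : A.domain, ‖(x : H)‖ ≤ K * ‖A x‖) (y : H) : ∃ x : A.domain, A x = y := by
  have hcl : IsClosed (A.graph : Set (H × H)) := hA.isClosed
  have : CompleteSpace A.graph := hcl.completeSpace_coe
  let S : A.graph →ₗ[ℂ] H := LinearMap.snd ℂ H H ∘ₗ A.graph.subtype
  have hS : AntilipschitzWith (max K.toNNReal 1) S := by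
    refine AddMonoidHomClass.antilipschitz_of_bound S fun z => ?_
    obtain ⟨x, hx1, hx2⟩ := (LinearPMap.mem_graph_iff _).1 z.2
    have h1 : ‖z.1.1‖ ≤ K.toNNReal * ‖z.1.2‖ := by
      rw [← hx1, ← hx2]
      exact (hK x).trans (mul_le_mul_of_nonneg_right (Real.le_coe_toNNReal K) (norm_nonneg _))
    change ‖z.1‖ ≤ _ * ‖z.1.2‖
    rw [Prod.norm_def, NNReal.coe_max, NNReal.coe_one]
    refine max_le (h1.trans ?_) ((one_mul ‖z.1.2‖).symm.le.trans ?_)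
    · exact mul_le_mul_of_nonneg_right (le_max_left _ _) (norm_nonneg _)
    · exact mul_le_mul_of_nonneg_right (le_max_right _ _) (norm_nonneg _)
  have hSc : UniformContinuous S := uniformContinuous_snd.comp uniformContinuous_subtype_val
  have hrange : IsClosed (LinearMap.range S : Set H) := hS.isClosed_range hSc
  have htop : LinearMap.range S = ⊤ := by
    rw [← hrange.submodule_topologicalClosure_eq, Submodule.topologicalClosure_eq_top_iff,
      Submodule.eq_bot_iff]
    intro v hv
    have hmem : (v, (0 : H)) ∈ A.graph := by
      rw [← LinearPMap.isSelfAdjoint_def.1 hA,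
        LinearPMap.adjoint_graph_eq_graph_adjoint hA.dense_domain, Submodule.mem_adjoint_iff]
      intro a b hab
      rw [inner_zero_right, sub_zero]
      exact hv b ⟨⟨(a, b), hab⟩, rfl⟩
    obtain ⟨x, hx1, hx2⟩ := (LinearPMap.mem_graph_iff _).1 hmem
    have := hK x
    rw [hx1, hx2, norm_zero, mul_zero] at this
    exact norm_le_zero_iff.1 this
  obtain ⟨z, rfl⟩ := (htop ▸ Submodule.mem_top : y ∈ LinearMap.range S)
  obtain ⟨x, -, hx⟩ := (LinearPMap.mem_graph_iff _).1 z.2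
  exact ⟨x, hx⟩

theorem exists_isBoundedInverse [CompleteSpace H] {A : H →ₗ.[ℂ] H} (hA : IsSelfAdjoint A)
    {K : ℝ}
    (hK : ∀ x : A.domain, ‖(x : H)‖ ≤ K * ‖A x‖) :
    ∃ B : H →L[ℂ] H, IsBoundedInverse A B ∧ ∀ y, ‖B y‖ ≤ K * ‖y‖ := by
  have hinj : Function.Injective A.toFun := by
    refine (injective_iff_map_eq_zero A.toFun).2 fun x hx => ?_
    have h := hK x
    rw [show A x = 0 from hx, norm_zero, mul_zero] at h
    exact Subtype.ext (norm_le_zero_iff.1 h)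
  let e : A.domain ≃ₗ[ℂ] H := LinearEquiv.ofBijective A.toFun
    ⟨hinj, exists_apply_eq_of_isSelfAdjoint_of_bound hA hK⟩
  have he : ∀ y, A (e.symm y) = y := e.apply_symm_apply
  have hB : ∀ y, ‖(A.domain.subtype ∘ₗ e.symm.toLinearMap) y‖ ≤ K * ‖y‖ := fun y => by
    have := hK (e.symm y)
    rwa [he] at this
  refine ⟨(A.domain.subtype ∘ₗ e.symm.toLinearMap).mkContinuous K hB,
    ⟨fun x => ?_, fun y => ?_⟩, hB⟩
  · exact congrArg Subtype.val (e.symm_apply_apply x)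
  · exact ⟨(e.symm y).2, he y⟩

/-- Inverses of operators with a common domain: uniform bounds on the inverses and pointwise
convergence of the operators on the domain give strong convergence of the inverses, because
`B ν - B∞ = B ν (A∞ - A ν) B∞`. -/
theorem tendsto_inverse_of_tendsto {A : ℕ → H →ₗ.[ℂ] H} {Ainf : H →ₗ.[ℂ] H} {B : ℕ → H →L[ℂ] H}
    {Binf : H →L[ℂ] H} (hB : ∀ ν, IsBoundedInverse (A ν) (B ν))
    (hBinf : IsBoundedInverse Ainf Binf) {K : ℝ} (hK : ∀ ν y, ‖B ν y‖ ≤ K * ‖y‖)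
    (hdom : ∀ ν, Ainf.domain ≤ (A ν).domain)
    (hlim : ∀ x : Ainf.domain, Tendsto (fun ν => A ν (Submodule.inclusion (hdom ν) x)) atTop
      (𝓝 (Ainf x))) (y : H) :
    Tendsto (fun ν => B ν y) atTop (𝓝 (Binf y)) := by
  obtain ⟨hx, hy⟩ := hBinf.2 y
  set x : Ainf.domain := ⟨Binf y, hx⟩
  rw [tendsto_iff_norm_sub_tendsto_zero]
  have h0 := ((tendsto_iff_norm_sub_tendsto_zero.1 (hlim x)).const_mul K)
  rw [mul_zero] at h0
  refine squeeze_zero (fun _ => norm_nonneg _) (fun ν => ?_) h0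
  have h1 := (hB ν).1 (Submodule.inclusion (hdom ν) x)
  have h2 : B ν y - Binf y = B ν (Ainf x - A ν (Submodule.inclusion (hdom ν) x)) := by
    rw [map_sub, h1, hy]
    rfl
  rw [h2, norm_sub_rev]
  exact hK ν _

end BoundedBelow

/-! ### Multiplication by bounded functions -/

section Multiplication

variable {n : ℕ} {Ω : Opens (EuclideanSpace ℝ (Fin n))}

theorem mulOp_apply (p : LInfty Ω) (q : L2n Ω) (j : Fin n) : mulOp p q j = (p • q j : L2 Ω) := rfl

theorem coeFn_mulOp (p : LInfty Ω) (q : L2n Ω) (j : Fin n) :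
    mulOp p q j =ᵐ[volume.restrict (Ω : Set (EuclideanSpace ℝ (Fin n)))]
      fun x => (p x : ℂ) * q j x := by
  rw [mulOp_apply]
  filter_upwards [Lp.coeFn_lpSMul (r := 2) p (q j)] with x hx
  rw [hx, Pi.smul_apply', Complex.real_smul]

theorem inner_mulOp_left (p : LInfty Ω) (q r : L2n Ω) :
    inner ℂ (mulOp p q) r = inner ℂ q (mulOp p r) := by
  rw [PiLp.inner_apply, PiLp.inner_apply]
  refine Finset.sum_congr rfl fun j _ => ?_
  rw [L2.inner_def, L2.inner_def]
  refine integral_congr_ae ?_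
  filter_upwards [coeFn_mulOp p q j, coeFn_mulOp p r j] with x h1 h2
  rw [h1, h2, RCLike.inner_apply, RCLike.inner_apply, map_mul, Complex.conj_ofReal]
  ring

theorem norm_mulOp_le (p : LInfty Ω) (q : L2n Ω) : ‖mulOp p q‖ ≤ ‖p‖ * ‖q‖ := by
  refine le_of_sq_le_sq ?_ (by positivity)
  rw [mul_pow, PiLp.norm_sq_eq_of_L2, PiLp.norm_sq_eq_of_L2, Finset.mul_sum]
  refine Finset.sum_le_sum fun j _ => ?_
  rw [← mul_pow, mulOp_apply]
  exact pow_le_pow_left₀ (norm_nonneg _) (Lp.norm_smul_le p (q j)) 2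

theorem le_re_inner_mulOp {p : LInfty Ω} {ε : ℝ}
    (hp : ∀ᵐ x ∂(volume.restrict (Ω : Set (EuclideanSpace ℝ (Fin n)))), ε ≤ p x) (q : L2n Ω) :
    ε * ‖q‖ ^ 2 ≤ (inner ℂ q (mulOp p q)).re := by
  rw [PiLp.norm_sq_eq_of_L2, PiLp.inner_apply, Finset.mul_sum, Complex.re_sum]
  refine Finset.sum_le_sum fun j _ => ?_
  have h1 : ‖q j‖ ^ 2 = (inner ℂ (q j) (q j)).re := (inner_self_eq_norm_sq (𝕜 := ℂ) _).symm
  rw [h1, ← Complex.re_ofReal_mul, L2.inner_def, L2.inner_def, ← integral_const_mul]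
  have hi1 : Integrable (fun x => (ε : ℂ) * inner ℂ (q j x) (q j x))
      (volume.restrict (Ω : Set (EuclideanSpace ℝ (Fin n)))) :=
    (L2.integrable_inner (q j) (q j)).const_mul _
  have hi2 := L2.integrable_inner (𝕜 := ℂ) (q j) (mulOp p q j)
  have e1 := integral_re hi1
  have e2 := integral_re hi2
  simp only [RCLike.re_to_complex] at e1 e2
  rw [← e1, ← e2]
  refine integral_mono_ae hi1.re hi2.re ?_
  filter_upwards [hp, coeFn_mulOp p q j] with x hx h
  have e : inner ℂ (q j x) (mulOp p q j x) = (p x : ℂ) * inner ℂ (q j x) (q j x) := by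
    rw [h, RCLike.inner_apply, RCLike.inner_apply, mul_assoc]
  simp only [e, Complex.re_ofReal_mul]
  exact mul_le_mul_of_nonneg_right hx (inner_self_nonneg (𝕜 := ℂ) (x := q j x))

theorem norm_sq_eq_integral (f : L2 Ω) :
    ‖f‖ ^ 2 = ∫ x in (Ω : Set (EuclideanSpace ℝ (Fin n))), ‖f x‖ ^ 2 := by
  have h : ((‖f‖ ^ 2 : ℝ) : ℂ)
      = ∫ x in (Ω : Set (EuclideanSpace ℝ (Fin n))), ((‖f x‖ ^ 2 : ℝ) : ℂ) := by
    rw [Complex.ofReal_pow]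
    refine (inner_self_eq_norm_sq_to_K (𝕜 := ℂ) f).symm.trans ?_
    rw [L2.inner_def]
    refine integral_congr_ae (Eventually.of_forall fun x => ?_)
    exact (inner_self_eq_norm_sq_to_K (𝕜 := ℂ) (f x)).trans (Complex.ofReal_pow _ _).symm
  rw [integral_complex_ofReal] at h
  exact Complex.ofReal_injective h

theorem ae_abs_le_norm (p : LInfty Ω) :
    ∀ᵐ x ∂(volume.restrict (Ω : Set (EuclideanSpace ℝ (Fin n)))), |p x| ≤ ‖p‖ := by
  filter_upwards [ae_le_eLpNormEssSup (f := p)] with x hx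
  rw [← eLpNorm_exponent_top] at hx
  have := ENNReal.toReal_mono (Lp.eLpNorm_ne_top p) hx
  rwa [toReal_enorm] at this

/-- Dominated convergence: multiplication operators converge strongly when the multipliers are
uniformly bounded and converge almost everywhere. -/
theorem tendsto_mulOp {p : ℕ → LInfty Ω} {pinf : LInfty Ω} {C : ℝ} (hC : ∀ ν, ‖p ν‖ ≤ C)
    (hlim : ∀ᵐ x ∂(volume.restrict (Ω : Set (EuclideanSpace ℝ (Fin n)))),
      Tendsto (fun ν => p ν x) atTop (𝓝 (pinf x))) (q : L2n Ω) :
    Tendsto (fun ν => mulOp (p ν) q) atTop (𝓝 (mulOp pinf q)) := by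
  have hcomp : ∀ j, Tendsto (fun ν => mulOp (p ν) q j) atTop (𝓝 (mulOp pinf q j)) := fun j => by
    rw [tendsto_iff_norm_sub_tendsto_zero]
    have hsq : ∀ ν, ‖mulOp (p ν) q j - mulOp pinf q j‖ ^ 2
        = ∫ x in (Ω : Set (EuclideanSpace ℝ (Fin n))), |p ν x - pinf x| ^ 2 * ‖q j x‖ ^ 2 :=
      fun ν => by
        rw [norm_sq_eq_integral]
        refine integral_congr_ae ?_
        filter_upwards [Lp.coeFn_sub (mulOp (p ν) q j) (mulOp pinf q j), coeFn_mulOp (p ν) q j,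
          coeFn_mulOp pinf q j] with x h1 h2 h3
        rw [h1, Pi.sub_apply, h2, h3, ← sub_mul, norm_mul, mul_pow, ← Complex.ofReal_sub,
          Complex.norm_real, Real.norm_eq_abs]
    have h0 : Tendsto (fun ν => ‖mulOp (p ν) q j - mulOp pinf q j‖ ^ 2) atTop (𝓝 0) := by
      simp only [hsq]
      rw [← integral_zero (EuclideanSpace ℝ (Fin n)) ℝ
        (μ := volume.restrict (Ω : Set (EuclideanSpace ℝ (Fin n))))]
      refine tendsto_integral_of_dominated_convergence
        (fun x => (C + ‖pinf‖) ^ 2 * ‖q j x‖ ^ 2) (fun ν => ?_) ?_ (fun ν => ?_) ?_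
      · exact (((Lp.aestronglyMeasurable (p ν)).sub (Lp.aestronglyMeasurable pinf)).norm.pow 2).mul
          ((Lp.aestronglyMeasurable (q j)).norm.pow 2)
      · exact ((memLp_two_iff_integrable_sq_norm (Lp.aestronglyMeasurable (q j))).1
          (Lp.memLp (q j))).const_mul _
      · filter_upwards [ae_abs_le_norm (p ν), ae_abs_le_norm pinf] with x h1 h2
        rw [Real.norm_of_nonneg (by positivity)]
        refine mul_le_mul_of_nonneg_right (pow_le_pow_left₀ (abs_nonneg _) ?_ 2) (by positivity)
        exact (abs_sub _ _).trans (add_le_add (h1.trans (hC ν)) h2)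
      · filter_upwards [hlim] with x hx
        have := (((hx.sub_const (pinf x)).abs).pow 2).mul_const (‖q j x‖ ^ 2)
        simpa using this
    have h1 := h0.sqrt
    simpa only [Real.sqrt_sq (norm_nonneg _), Real.sqrt_zero] using h1
  exact ((PiLp.continuous_toLp 2 fun _ : Fin n => L2 Ω).tendsto _).comp (tendsto_pi_nhds.2 hcomp)

end Multiplication

/-! ### The operator `Â` -/

section MixedOperator

variable {n : ℕ} {Ω : Opens (EuclideanSpace ℝ (Fin n))}

/-- `Â z = w`, component by component. The term `p q` is moved to the side of `w`, so that the
second condition is about the weak gradient alone. -/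
theorem mem_graph_mixedOp_iff (p : LInfty Ω) (z w : MixedSpace Ω) :
    (z, w) ∈ (mixedOp p).graph ↔
      (z.snd, w.fst) ∈ ((grad0 Ω)†).graph ∧ HasGrad0 Ω z.fst (w.snd + mulOp p z.snd) := by
  rw [LinearPMap.mem_graph_iff, LinearPMap.mem_graph_iff]
  constructor
  · rintro ⟨x, rfl, rfl⟩
    obtain ⟨⟨u, hu⟩, hu0, hux : u = _⟩ := x.2.1
    subst hux
    exact ⟨⟨⟨_, mixedDomain_snd_mem x⟩, rfl, rfl⟩, hu, hu0, (sub_add_cancel _ _).symm⟩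
  · rintro ⟨⟨⟨_, hq⟩, rfl, hw1⟩, h, h0, hw2⟩
    refine ⟨⟨z, ⟨_, h0, rfl⟩, hq⟩, rfl, ?_⟩
    refine (WithLp.ofLp_injective 2) (Prod.ext hw1 ?_)
    exact sub_eq_of_eq_add hw2

theorem toLp_mem_graph_mixedOp (p : LInfty Ω) {u f : L2 Ω} {q g : L2n Ω}
    (hq : (q, f) ∈ ((grad0 Ω)†).graph) (hu : HasGrad0 Ω u g) :
    (WithLp.toLp 2 (u, q), WithLp.toLp 2 (f, g - mulOp p q)) ∈ (mixedOp p).graph := by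
  refine (mem_graph_mixedOp_iff p _ _).2 ⟨hq, ?_⟩
  change HasGrad0 Ω u (g - mulOp p q + mulOp p q)
  rwa [sub_add_cancel]

theorem dense_domain_mixedOp (p : LInfty Ω) : Dense ((mixedOp p).domain : Set (MixedSpace Ω)) := by
  rw [Submodule.dense_iff_topologicalClosure_eq_top, Submodule.topologicalClosure_eq_top_iff,
    Submodule.eq_bot_iff]
  intro z hz
  have key : ∀ v r q f, HasGrad0 Ω v r → (q, f) ∈ ((grad0 Ω)†).graph →
      inner ℂ v z.fst + inner ℂ q z.snd = 0 := fun v r q f hv hq => by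
    have hm := toLp_mem_graph_mixedOp p hq hv
    exact (WithLp.prod_inner_apply _ _).symm.trans (hz _ (LinearPMap.mem_domain_of_mem_graph hm))
  have h1 : z.fst = 0 := eq_zero_of_forall_inner_testToL2 Ω _ fun φ => by
    have := key _ _ 0 0 (hasGrad0_testToL2 Ω φ) (zero_mem _)
    rwa [inner_zero_left, add_zero] at this
  have h2 : z.snd = 0 := by
    ext1 j
    refine eq_zero_of_forall_inner_testToL2 Ω _ fun φ => ?_
    have := key _ _ _ _ (hasGrad0_zero Ω) (single_testToL2_mem_graph_adjoint_grad0 Ω j φ)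
    rwa [inner_zero_left, zero_add, inner_piLp_single_left] at this
  exact (WithLp.ofLp_injective 2) (Prod.ext h1 h2)

/-- The condition defining the adjoint of `Â` at `(z, w)` separates into a condition on `u`,
`g = ∇u` and one on `q`, `f = ∇₀^* q`: by the symmetry of multiplication by `p`, the term `p q` goes over to
`z`. -/
theorem mem_adjoint_graph_mixedOp_iff (p : LInfty Ω) (z w : MixedSpace Ω) :
    (z, w) ∈ (mixedOp p).graph.adjoint ↔
      ∀ u q f g, (q, f) ∈ ((grad0 Ω)†).graph → HasGrad0 Ω u g →
        (inner ℂ f z.fst - inner ℂ q (w.snd + mulOp p z.snd))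
          + (inner ℂ g z.snd - inner ℂ u w.fst) = 0 := by
  have hinner : ∀ (u : L2 Ω) (q : L2n Ω) (f : L2 Ω) (g : L2n Ω),
      inner ℂ (WithLp.toLp 2 (f, g - mulOp p q)) z - inner ℂ (WithLp.toLp 2 (u, q)) w
      = (inner ℂ f z.fst - inner ℂ q (w.snd + mulOp p z.snd))
        + (inner ℂ g z.snd - inner ℂ u w.fst) := fun u q f g => by
    have h1 : inner ℂ (WithLp.toLp 2 (f, g - mulOp p q)) z
        = inner ℂ f z.fst + inner ℂ (g - mulOp p q) z.snd := WithLp.prod_inner_apply _ _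
    have h2 : inner ℂ (WithLp.toLp 2 (u, q)) w = inner ℂ u w.fst + inner ℂ q w.snd :=
      WithLp.prod_inner_apply _ _
    rw [h1, h2, inner_add_right, inner_sub_left, inner_mulOp_left]
    ring
  rw [Submodule.mem_adjoint_iff]
  constructor
  · intro h u q f g hq hu
    rw [← hinner]
    exact h _ _ (toLp_mem_graph_mixedOp p hq hu)
  · intro h a b hab
    obtain ⟨hq, hu⟩ := (mem_graph_mixedOp_iff p a b).1 hab
    have h1 := h _ _ _ _ hq hu
    rw [← hinner, add_sub_cancel_right] at h1
    exact h1

/-- For `p = 0` the operator is off-diagonal, with the entries `∇₀^*` and `(∇₀^*)^*`; multiplication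
by the real function `p` is a bounded symmetric perturbation. -/
theorem isSelfAdjoint_mixedOp (p : LInfty Ω) : IsSelfAdjoint (mixedOp p) := by
  rw [LinearPMap.isSelfAdjoint_def]
  refine LinearPMap.eq_of_eq_graph ?_
  rw [LinearPMap.adjoint_graph_eq_graph_adjoint (dense_domain_mixedOp p)]
  ext ⟨z, w⟩
  rw [mem_adjoint_graph_mixedOp_iff, mem_graph_mixedOp_iff]
  constructor
  · intro h
    constructor
    · refine (mem_graph_adjoint_onTestFunctions_iff Ω _ _ _).2 fun φ => ?_
      have h1 := h _ 0 0 _ (zero_mem _) (hasGrad0_testToL2 Ω φ)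
      rw [inner_zero_left, inner_zero_left, sub_zero, zero_add, sub_eq_zero] at h1
      rw [← inner_conj_symm, ← h1, inner_conj_symm]
    · refine (hasGrad0_iff Ω _ _).2 fun q f hqf => ?_
      have h1 := h _ _ _ _ hqf (hasGrad0_zero Ω)
      rwa [inner_zero_left, inner_zero_left, sub_zero, add_zero, sub_eq_zero] at h1
  · rintro ⟨hz2, hz1⟩ u q f g hq hu
    have h1 := (hasGrad0_iff Ω _ _).1 hz1 _ _ hq
    have h2 := (hasGrad0_iff Ω _ _).1 hu _ _ hz2
    rw [h1, sub_self, zero_add, ← inner_conj_symm, ← h2, inner_conj_symm, sub_self]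

/-- The a priori bound: pairing the second component of `Â(u, q) = (f, g)` with `q` gives
`ε ‖q‖² ≤ ‖f‖ ‖u‖ + ‖g‖ ‖q‖`, and by the Poincaré inequality `c ‖u‖ ≤ ‖∇u‖ ≤ ‖g‖ + C ‖q‖`. The
constant depends only on the bounds `ε` and `C` of `p` and on the Poincaré constant `c`. -/
theorem exists_norm_le_mul_norm_mixedOp (hΩ : PoincareInequality Ω) {ε : ℝ} (hε : 0 < ε) (C : ℝ) :
    ∃ K : ℝ, ∀ p : LInfty Ω, ‖p‖ ≤ C →
      (∀ᵐ x ∂(volume.restrict (Ω : Set (EuclideanSpace ℝ (Fin n)))), ε ≤ p x) →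
      ∀ x : (mixedOp p).domain, ‖(x : MixedSpace Ω)‖ ≤ K * ‖mixedOp p x‖ := by
  obtain ⟨j, c, hc, hP⟩ := hΩ
  -- `k` bounds `‖q‖` in terms of `‖(f, g)‖`: where `‖q‖ ≥ ‖(f, g)‖`, the quadratic inequality
  -- `hcoer` is linear in `‖q‖` up to a factor `‖q‖`; the summand `1` covers the other case.
  set k := 1 + (c⁻¹ + (c⁻¹ * C + 1)) / ε with hk
  refine ⟨c⁻¹ * (1 + C * k) + k, fun p hpC hpε x => ?_⟩
  have hC : 0 ≤ C := (norm_nonneg p).trans hpC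
  have hgr : ((x : MixedSpace Ω), mixedOp p x) ∈ (mixedOp p).graph := LinearPMap.mem_graph _ x
  generalize (x : MixedSpace Ω) = z at hgr ⊢
  generalize mixedOp p x = w at hgr ⊢
  obtain ⟨hq, hu⟩ := (mem_graph_mixedOp_iff p z w).1 hgr
  have hinner := (hasGrad0_iff Ω _ _).1 hu _ _ hq
  have hw1 : ‖w.fst‖ ≤ ‖w‖ := WithLp.norm_fst_le _ w
  have hw2 : ‖w.snd‖ ≤ ‖w‖ := WithLp.norm_snd_le _ w
  have hgrad : ‖w.snd + mulOp p z.snd‖ ≤ ‖w‖ + C * ‖z.snd‖ :=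
    (norm_add_le _ _).trans (add_le_add hw2
      ((norm_mulOp_le p _).trans (mul_le_mul_of_nonneg_right hpC (norm_nonneg _))))
  have hu' : ‖z.fst‖ ≤ c⁻¹ * (‖w‖ + C * ‖z.snd‖) := by
    obtain ⟨h, h0, hg⟩ := hu
    rw [← div_eq_inv_mul, le_div_iff₀' hc]
    refine (hP _ h0).trans ((PiLp.norm_apply_le _ j).trans ?_)
    rwa [hg]
  have hcoer : ε * ‖z.snd‖ ^ 2 ≤ ‖w‖ * (c⁻¹ * (‖w‖ + C * ‖z.snd‖)) + ‖z.snd‖ * ‖w‖ := by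
    refine (le_re_inner_mulOp hpε z.snd).trans ?_
    rw [inner_add_right, ← sub_eq_iff_eq_add'] at hinner
    rw [← hinner, Complex.sub_re]
    have h1 : (inner ℂ w.fst z.fst).re ≤ ‖w‖ * (c⁻¹ * (‖w‖ + C * ‖z.snd‖)) :=
      (re_inner_le_norm (𝕜 := ℂ) _ _).trans
        (mul_le_mul hw1 hu' (norm_nonneg _) (norm_nonneg _))
    have h2 : -(inner ℂ z.snd w.snd).re ≤ ‖z.snd‖ * ‖w‖ :=
      (neg_le_abs _).trans ((Complex.abs_re_le_norm _).trans ((norm_inner_le_norm _ _).trans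
        (mul_le_mul_of_nonneg_left hw2 (norm_nonneg _))))
    linarith
  have hwn := norm_nonneg w
  have hkey : ‖z.snd‖ ≤ k * ‖w‖ := by
    by_contra! hlt
    have hc' : 0 < c⁻¹ := inv_pos.2 hc
    have hk1 : 1 ≤ k := le_add_of_nonneg_right (by positivity)
    have hwz : ‖w‖ ≤ ‖z.snd‖ := (le_mul_of_one_le_left hwn hk1).trans hlt.le
    have hzpos : 0 < ‖z.snd‖ := (mul_nonneg (zero_le_one.trans hk1) hwn).trans_lt hlt
    have h1 : ε * ‖z.snd‖ ^ 2 ≤ ((c⁻¹ + (c⁻¹ * C + 1)) * ‖w‖) * ‖z.snd‖ := by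
      have : c⁻¹ * (‖w‖ * ‖w‖) ≤ c⁻¹ * (‖w‖ * ‖z.snd‖) := by gcongr
      linarith
    have h2 : ε * ‖z.snd‖ ≤ (c⁻¹ + (c⁻¹ * C + 1)) * ‖w‖ := by
      rw [sq, ← mul_assoc] at h1
      exact le_of_mul_le_mul_right h1 hzpos
    have h3 : ε * (k * ‖w‖) = ε * ‖w‖ + (c⁻¹ + (c⁻¹ * C + 1)) * ‖w‖ := by
      rw [hk]
      field_simp
    have h4 := mul_lt_mul_of_pos_left hlt hε
    have := mul_nonneg hε.le hwn
    linarith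
  have hsum : ‖z‖ ≤ ‖z.fst‖ + ‖z.snd‖ := by
    rw [WithLp.prod_norm_eq_of_L2]
    refine Real.sqrt_le_iff.2 ⟨by positivity, ?_⟩
    nlinarith [norm_nonneg z.fst, norm_nonneg z.snd]
  calc ‖z‖ ≤ c⁻¹ * (‖w‖ + C * ‖z.snd‖) + ‖z.snd‖ := hsum.trans (by gcongr)
    _ ≤ c⁻¹ * (‖w‖ + C * (k * ‖w‖)) + k * ‖w‖ := by gcongr
    _ = (c⁻¹ * (1 + C * k) + k) * ‖w‖ := by ring

theorem domain_mixedOp (p : LInfty Ω) : (mixedOp p).domain = mixedDomain Ω := rfl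

theorem mixedOp_apply (p : LInfty Ω) (x : mixedDomain Ω)
    (h : (x : MixedSpace Ω) ∈ (mixedOp p).domain) :
    mixedOp p ⟨x, h⟩ = WithLp.toLp 2
      ((grad0 Ω)† ⟨(x : MixedSpace Ω).snd, mixedDomain_snd_mem x⟩,
        weakGrad Ω ⟨(x : MixedSpace Ω).fst, mixedDomain_fst_mem x⟩
          - mulOp p (x : MixedSpace Ω).snd) := rfl

/-- Only the bounded term `p q` of `Â(u, q)` depends on `p`. -/
theorem tendsto_mixedOp {p : ℕ → LInfty Ω} {pinf : LInfty Ω} {C : ℝ} (hC : ∀ ν, ‖p ν‖ ≤ C)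
    (hlim : ∀ᵐ x ∂(volume.restrict (Ω : Set (EuclideanSpace ℝ (Fin n)))),
      Tendsto (fun ν => p ν x) atTop (𝓝 (pinf x)))
    (hdom : ∀ ν, (mixedOp pinf).domain ≤ (mixedOp (p ν)).domain) (x : (mixedOp pinf).domain) :
    Tendsto (fun ν => mixedOp (p ν) (Submodule.inclusion (hdom ν) x)) atTop
      (𝓝 (mixedOp pinf x)) := by
  obtain ⟨x, hx⟩ := x
  have hx' : x ∈ mixedDomain Ω := hx
  have h := (tendsto_mulOp hC hlim x.snd).const_sub
    (weakGrad Ω ⟨x.fst, mixedDomain_fst_mem ⟨x, hx'⟩⟩)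
  have h1 : ∀ ν, mixedOp (p ν) (Submodule.inclusion (hdom ν) ⟨x, hx⟩) = _ := fun ν =>
    mixedOp_apply (p ν) ⟨x, hx'⟩ (hdom ν hx)
  rw [mixedOp_apply pinf ⟨x, hx'⟩ hx]
  simp only [h1]
  exact ((WithLp.prod_continuous_toLp 2 _ _).tendsto _).comp (tendsto_const_nhds.prodMk_nhds h)

end MixedOperator

end RoughDiffusion

theorem mainTheorem1 {n : ℕ} (Ω : Opens (EuclideanSpace ℝ (Fin n)))
    (hΩ : (Ω : Set (EuclideanSpace ℝ (Fin n))).Nonempty)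
    (hPoincare : RoughDiffusion.PoincareInequality Ω)
    (p : ℕ → RoughDiffusion.LInfty Ω) (pinf : RoughDiffusion.LInfty Ω)
    (hp : ∀ ν, p ν ∈ RoughDiffusion.diffusivityClass Ω)
    (hpinf : pinf ∈ RoughDiffusion.diffusivityClass Ω)
    (hbdd : ∃ C : ℝ, ∀ ν, ‖p ν‖ ≤ C)
    (hlower : ∃ ε : ℝ, 0 < ε ∧
      ∀ ν, ∀ᵐ x ∂(volume.restrict (Ω : Set (EuclideanSpace ℝ (Fin n)))), ε ≤ p ν x)
    (hlim : ∀ᵐ x ∂(volume.restrict (Ω : Set (EuclideanSpace ℝ (Fin n)))),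
      Tendsto (fun ν => p ν x) atTop (𝓝 (pinf x))) :
    (∀ ν, IsSelfAdjoint (RoughDiffusion.mixedOp (p ν))) ∧
    IsSelfAdjoint (RoughDiffusion.mixedOp pinf) ∧
    ∃ (B : ℕ → RoughDiffusion.MixedSpace Ω →L[ℂ] RoughDiffusion.MixedSpace Ω)
      (Binf : RoughDiffusion.MixedSpace Ω →L[ℂ] RoughDiffusion.MixedSpace Ω),
      (∀ ν, RoughDiffusion.IsBoundedInverse (RoughDiffusion.mixedOp (p ν)) (B ν)) ∧
      RoughDiffusion.IsBoundedInverse (RoughDiffusion.mixedOp pinf) Binf ∧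
      ∀ y : RoughDiffusion.MixedSpace Ω, Tendsto (fun ν => B ν y) atTop (𝓝 (Binf y)) := by
  obtain ⟨C, hC⟩ := hbdd
  obtain ⟨ε, hε, hpε⟩ := hlower
  obtain ⟨K, hK⟩ := RoughDiffusion.exists_norm_le_mul_norm_mixedOp hPoincare hε C
  obtain ⟨ε', _, hε', _, hpinfε⟩ := hpinf
  obtain ⟨Kinf, hKinf⟩ := RoughDiffusion.exists_norm_le_mul_norm_mixedOp hPoincare hε' ‖pinf‖
  choose B hB hBK using fun ν => RoughDiffusion.exists_isBoundedInverse
    (RoughDiffusion.isSelfAdjoint_mixedOp (p ν)) (hK (p ν) (hC ν) (hpε ν))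
  obtain ⟨Binf, hBinf, -⟩ := RoughDiffusion.exists_isBoundedInverse
    (RoughDiffusion.isSelfAdjoint_mixedOp pinf)
    (hKinf pinf le_rfl (hpinfε.mono fun x hx => hx.1))
  refine ⟨fun ν => RoughDiffusion.isSelfAdjoint_mixedOp _, RoughDiffusion.isSelfAdjoint_mixedOp _,
    B, Binf, hB, hBinf, ?_⟩
  have hdom : ∀ ν, (RoughDiffusion.mixedOp pinf).domain ≤ (RoughDiffusion.mixedOp (p ν)).domain :=
    fun ν => by rw [RoughDiffusion.domain_mixedOp, RoughDiffusion.domain_mixedOp]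
  exact RoughDiffusion.tendsto_inverse_of_tendsto hB hBinf hBK hdom
    (RoughDiffusion.tendsto_mixedOp hC hlim hdom)
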